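/- Let $d\ge 1$. Call a function $\Phi\in L^1_{\mathrm{loc}}(\mathbb R^n)$ slowly increasing if there are $c,k,R>1$ with $|\Phi(x)|\le c\|x\|^k$ for all $\|x\|>R$; such a $\Phi$ is identified with the tempered distribution $\varphi\mapsto\int_{\mathbb R^n}\Phi\varphi\,dx$ on $\mathbb R^n$. Let $\mathcal F_n$ be the Fourier transform on $\mathcal S'(\mathbb R^n)$, $\langle\mathcal F_nT,\varphi\rangle=\langle T,\mathcal F_n\varphi\rangle$, where $\mathcal F_n\varphi(v)=\int_{\mathbb R^n}e^{-2\pi i\langle x,v\rangle}\varphi(x)\,dx$ for $\varphi\in\mathcal S(\mathbb R^n)$. For $F\colon[0,\infty)\to\mathbb R$ put $\mathcal R_dF=F(\|\cdot\|)\colon\mathbb R^d\to\mathbb R$. For $T\in\mathcal S'(\mathbb R^d)$ define $\mathcal R_d^\star T\in\mathcal S'(\mathbb R)$ by $\langle\mathcal R_d^\star T,\psi\rangle=\langle T,(\mathcal A_1\psi)(\|\cdot\|)\rangle$ for $\psi\in\mathcal S(\mathbb R)$, where $\mathcal A_1\psi(r)=\tfrac12(\psi(r)+\psi(-r))$. Let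 $F\colon[0,\infty)\to\mathbb R$ be such that $\mathcal R_dF$ is slowly increasing on $\mathbb R^d$ and such that the tempered distribution $$(\mathcal F_1\circ\mathcal R_d^\star\circ\mathcal F_d^{-1})[\mathcal R_dF]$$ is generated by a slowly increasing function $f$ on $\mathbb R$. If $f$ is continuous and $F$ is continuous at $\|z\|$ for some $z\in\mathbb R^d$, then $$F(\|z\|)=\mathbb E_{\xi\sim\mathcal U_{\mathbb S^{d-1}}}\bigl[f(|\langle z,\xi\rangle|)\bigr],$$ where $\mathcal U_{\mathbb S^{d-1}}$ is the uniform distribution on the unit sphere $\mathbb S^{d-1}\subset\mathbb R^d$. -/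

import Mathlib

open MeasureTheory Metric Set Topology Filter
open scoped SchwartzMap FourierTransform ContDiff NNReal ENNReal InnerProductSpace

noncomputable section

namespace Slicing

/-! ### Slowly increasing functions and regular tempered distributions -/

/-- A locally integrable function `Φ` is slowly increasing if there are `c, k, R > 1` such that
`|Φ x| ≤ c ‖x‖ ^ k` whenever `‖x‖ > R`. -/
def SlowlyIncreasing {E : Type*} [NormedAddCommGroup E] [MeasureSpace E] (Φ : E → ℂ) : Prop :=
  LocallyIntegrable Φ ∧
    ∃ c k R : ℝ, 1 < c ∧ 1 < k ∧ 1 < R ∧ ∀ x : E, R < ‖x‖ → ‖Φ x‖ ≤ c * ‖x‖ ^ k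

section Regular

variable {E : Type*} [NormedAddCommGroup E] [NormedSpace ℝ E] [FiniteDimensional ℝ E]
  [MeasureSpace E] [BorelSpace E] [(volume : Measure E).IsAddHaarMeasure]

theorem SlowlyIncreasing.exists_integrable {Φ : E → ℂ} (h : SlowlyIncreasing Φ) :
    ∃ N : ℕ, Integrable (fun x : E => (1 + ‖x‖) ^ (-(N : ℝ)) * ‖Φ x‖) := by
  obtain ⟨hloc, c, k, R, hc, hk, hR, hb⟩ := h
  obtain ⟨n, hn⟩ := (inferInstance : (volume : Measure E).HasTemperateGrowth).exists_integrable
  obtain ⟨m, hm⟩ := exists_nat_ge k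
  refine ⟨n + m, ?_⟩
  have hmeas : AEStronglyMeasurable
      (fun x : E => (1 + ‖x‖) ^ (-((n + m : ℕ) : ℝ)) * ‖Φ x‖) volume := by
    refine AEStronglyMeasurable.mul ?_ hloc.aestronglyMeasurable.norm
    refine Continuous.aestronglyMeasurable ?_
    refine Continuous.rpow_const (by fun_prop) fun x => Or.inl ?_
    positivity
  have hint : IntegrableOn (fun x : E => ‖Φ x‖) (closedBall 0 R) :=
    (hloc.integrableOn_isCompact (isCompact_closedBall 0 R)).norm
  have hind : Integrable ((closedBall (0 : E) R).indicator fun x : E => ‖Φ x‖) :=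
    (integrable_indicator_iff measurableSet_closedBall).2 hint
  refine Integrable.mono' (hind.add (hn.const_mul c)) hmeas (Eventually.of_forall fun x => ?_)
  have h1 : (1 : ℝ) ≤ 1 + ‖x‖ := by simp
  have h0 : (0 : ℝ) < 1 + ‖x‖ := by positivity
  rw [Real.norm_of_nonneg (by positivity), Pi.add_apply]
  by_cases hx : x ∈ closedBall (0 : E) R
  · rw [indicator_of_mem hx]
    have h2 : (1 + ‖x‖) ^ (-((n + m : ℕ) : ℝ)) ≤ 1 :=
      Real.rpow_le_one_of_one_le_of_nonpos h1 (neg_nonpos.2 (Nat.cast_nonneg _))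
    have h3 : 0 ≤ c * (1 + ‖x‖) ^ (-(n : ℝ)) := by positivity
    nlinarith [norm_nonneg (Φ x)]
  · rw [indicator_of_notMem hx, zero_add]
    have hx' : R < ‖x‖ := by simpa using hx
    have h4 : ‖x‖ ^ k ≤ (1 + ‖x‖) ^ (m : ℝ) :=
      (Real.rpow_le_rpow (norm_nonneg x) (by linarith) (by linarith)).trans
        (Real.rpow_le_rpow_of_exponent_le h1 hm)
    calc (1 + ‖x‖) ^ (-((n + m : ℕ) : ℝ)) * ‖Φ x‖
        ≤ (1 + ‖x‖) ^ (-((n + m : ℕ) : ℝ)) * (c * (1 + ‖x‖) ^ (m : ℝ)) := by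
          gcongr
          exact (hb x hx').trans (by gcongr)
      _ = c * (1 + ‖x‖) ^ (-(n : ℝ)) := by
          rw [mul_left_comm, ← Real.rpow_add h0]
          congr 2
          push_cast
          ring

theorem SlowlyIncreasing.exists_bound {Φ : E → ℂ} (h : SlowlyIncreasing Φ) :
    ∃ (s : Finset (ℕ × ℕ)) (C : ℝ), 0 ≤ C ∧ ∀ φ : 𝓢(E, ℂ),
      Integrable (fun x : E => Φ x * φ x) ∧
      ‖∫ x : E, Φ x * φ x‖ ≤ C * s.sup (schwartzSeminormFamily ℂ E ℂ) φ := by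
  obtain ⟨N, hN⟩ := h.exists_integrable
  refine ⟨Finset.Iic (N, 0), (∫ x : E, (1 + ‖x‖) ^ (-(N : ℝ)) * ‖Φ x‖) * 2 ^ N,
    by positivity, fun φ => ?_⟩
  set S := (Finset.Iic (N, 0)).sup (schwartzSeminormFamily ℂ E ℂ) φ with hS
  have hb : ∀ x : E, ‖Φ x * φ x‖ ≤ ((1 + ‖x‖) ^ (-(N : ℝ)) * ‖Φ x‖) * (2 ^ N * S) := by
    intro x
    have h1 : (1 + ‖x‖) ^ N * ‖φ x‖ ≤ 2 ^ N * S := by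
      have h := SchwartzMap.one_add_le_sup_seminorm_apply (𝕜 := ℂ) (m := (N, 0)) (k := N) (n := 0)
        le_rfl le_rfl φ x
      rw [norm_iteratedFDeriv_zero] at h
      exact h
    have h2 : ‖φ x‖ ≤ (1 + ‖x‖) ^ (-(N : ℝ)) * (2 ^ N * S) := by
      rw [Real.rpow_neg (by positivity), ← div_eq_inv_mul, le_div_iff₀' (by positivity),
        Real.rpow_natCast]
      exact h1
    rw [norm_mul]
    calc ‖Φ x‖ * ‖φ x‖ ≤ ‖Φ x‖ * ((1 + ‖x‖) ^ (-(N : ℝ)) * (2 ^ N * S)) := by gcongr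
      _ = _ := by ring
  have hi : Integrable (fun x : E => Φ x * φ x) :=
    Integrable.mono' (hN.mul_const _)
      (h.1.aestronglyMeasurable.mul φ.continuous.aestronglyMeasurable) (Eventually.of_forall hb)
  refine ⟨hi, ?_⟩
  calc ‖∫ x : E, Φ x * φ x‖ ≤ ∫ x : E, ((1 + ‖x‖) ^ (-(N : ℝ)) * ‖Φ x‖) * (2 ^ N * S) :=
        norm_integral_le_of_norm_le (hN.mul_const _) (Eventually.of_forall hb)
    _ = _ := by rw [integral_mul_const]; ring

/-- The regular tempered distribution `φ ↦ ∫ Φ φ` generated by a slowly increasing function. -/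
def SlowlyIncreasing.toDistribution {Φ : E → ℂ} (h : SlowlyIncreasing Φ) : 𝓢'(E, ℂ) :=
  ContinuousLinearMap.toPointwiseConvergenceCLM _ _ _ _ <|
    SchwartzMap.mkCLMtoNormedSpace (𝕜 := ℂ) (σ := RingHom.id ℂ)
      (fun φ : 𝓢(E, ℂ) => ∫ x : E, Φ x * φ x)
      (fun f g => by
        obtain ⟨s, C, -, hb⟩ := h.exists_bound
        simp only [add_apply, mul_add]
        exact integral_add (hb f).1 (hb g).1)
      (fun a f => by
        simp only [smul_apply, smul_eq_mul, RingHom.id_apply, mul_left_comm _ a]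
        exact integral_const_mul a _)
      (by
        obtain ⟨s, C, hC, hb⟩ := h.exists_bound
        exact ⟨s, C, hC, fun φ => (hb φ).2⟩)

theorem SlowlyIncreasing.toDistribution_apply {Φ : E → ℂ} (h : SlowlyIncreasing Φ)
    (φ : 𝓢(E, ℂ)) : h.toDistribution φ = ∫ x : E, Φ x * φ x := rfl

end Regular

/-! ### Averaging and rotation of one-dimensional Schwartz functions -/

/-- One-dimensional averaging operator `𝒜₁`, i.e. `𝒜₁ ψ r = (ψ r + ψ (-r)) / 2`. -/
def avgOne : 𝓢(ℝ, ℂ) →L[ℂ] 𝓢(ℝ, ℂ) :=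
  (2⁻¹ : ℂ) • (ContinuousLinearMap.id ℂ 𝓢(ℝ, ℂ) +
    SchwartzMap.compCLMOfContinuousLinearEquiv ℂ (ContinuousLinearEquiv.neg ℝ))

theorem avgOne_apply (ψ : 𝓢(ℝ, ℂ)) (r : ℝ) : avgOne ψ r = (ψ r + ψ (-r)) / 2 := by
  simp [avgOne, div_eq_inv_mul, mul_add]

theorem avgOne_neg (ψ : 𝓢(ℝ, ℂ)) (r : ℝ) : avgOne ψ (-r) = avgOne ψ r := by
  simp [avgOne_apply, add_comm]

theorem avgOne_of_even {ψ : 𝓢(ℝ, ℂ)} (h : ∀ r, ψ (-r) = ψ r) : avgOne ψ = ψ := by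
  ext r; simp [avgOne_apply, h]

theorem deriv_zero_of_even {ψ : 𝓢(ℝ, ℂ)} (h : ∀ r, ψ (-r) = ψ r) : deriv ψ 0 = 0 := by
  have h1 : deriv (fun r => ψ (-r)) 0 = -deriv ψ (-0) := deriv_comp_neg (f := ψ) 0
  rw [funext h, neg_zero] at h1
  exact self_eq_neg.1 h1

/-- The moment integral `∫₀¹ tⁿ g(t x) dt`. -/
def moment (n : ℕ) (g : 𝓢(ℝ, ℂ)) (x : ℝ) : ℂ := ∫ t in (0 : ℝ)..1, (t : ℂ) ^ n * g (t * x)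

theorem moment_hasDerivAt (n : ℕ) (g : 𝓢(ℝ, ℂ)) (x : ℝ) :
    HasDerivAt (moment n g) (moment (n + 1) (SchwartzMap.derivCLM ℂ ℂ g) x) x := by
  set g' := SchwartzMap.derivCLM ℂ ℂ g with hg'
  have hc := g.continuous
  have hc' := g'.continuous
  refine (intervalIntegral.hasDerivAt_integral_of_dominated_loc_of_deriv_le
    (F := fun x t => (t : ℂ) ^ n * g (t * x)) (F' := fun x t => (t : ℂ) ^ (n + 1) * g' (t * x))
    (bound := fun _ => SchwartzMap.seminorm ℂ 0 0 g') (s := univ) univ_mem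
    (Eventually.of_forall fun y => ?_) ?_ ?_ ?_ ?_ ?_).2
  · exact Continuous.aestronglyMeasurable (by fun_prop)
  · exact Continuous.intervalIntegrable (by fun_prop) _ _
  · exact Continuous.aestronglyMeasurable (by fun_prop)
  · refine Eventually.of_forall fun t ht y _ => ?_
    rw [uIoc_of_le zero_le_one] at ht
    rw [norm_mul, norm_pow, Complex.norm_real, Real.norm_of_nonneg ht.1.le]
    have h1 : t ^ (n + 1) ≤ 1 := pow_le_one₀ ht.1.le ht.2
    have h2 := SchwartzMap.norm_le_seminorm ℂ g' (t * y)
    calc t ^ (n + 1) * ‖g' (t * y)‖ ≤ 1 * ‖g' (t * y)‖ := by gcongr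
      _ ≤ _ := by rw [one_mul]; exact h2
  · exact intervalIntegrable_const
  · refine Eventually.of_forall fun t _ y _ => ?_
    have h1 : HasDerivAt (fun y : ℝ => t * y) t y := by
      simpa using (hasDerivAt_id y).const_mul t
    have h2 : HasDerivAt g (g' (t * y)) (t * y) := by
      rw [hg', SchwartzMap.derivCLM_apply]
      exact g.differentiableAt.hasDerivAt
    have h3 := (h2.scomp y h1).const_mul ((t : ℂ) ^ n)
    refine h3.congr_deriv ?_
    simp only [Complex.real_smul]
    ring

theorem moment_iteratedDeriv (m n : ℕ) (g : 𝓢(ℝ, ℂ)) :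
    iteratedDeriv m (moment n g) = moment (n + m) ((SchwartzMap.derivCLM ℂ ℂ)^[m] g) := by
  induction m with
  | zero => simp
  | succ m ih =>
    rw [iteratedDeriv_succ, ih, Function.iterate_succ_apply']
    funext x
    exact (moment_hasDerivAt _ _ x).deriv

theorem moment_contDiff (n : ℕ) (g : 𝓢(ℝ, ℂ)) : ContDiff ℝ ∞ (moment n g) := by
  refine contDiff_of_differentiable_iteratedDeriv fun m _ => ?_
  rw [moment_iteratedDeriv]
  exact fun x => (moment_hasDerivAt _ _ x).differentiableAt

theorem moment_norm_le (n : ℕ) (g : 𝓢(ℝ, ℂ)) (x : ℝ) :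
    ‖moment n g x‖ ≤ SchwartzMap.seminorm ℂ 0 0 g := by
  have := intervalIntegral.norm_integral_le_of_norm_le_const (a := (0 : ℝ)) (b := 1)
    (f := fun t : ℝ => (t : ℂ) ^ n * g (t * x)) (C := SchwartzMap.seminorm ℂ 0 0 g) (by
      intro t ht
      rw [uIoc_of_le zero_le_one] at ht
      rw [norm_mul, norm_pow, Complex.norm_real, Real.norm_of_nonneg ht.1.le]
      have h1 : t ^ n ≤ 1 := pow_le_one₀ ht.1.le ht.2
      calc t ^ n * ‖g (t * x)‖ ≤ 1 * ‖g (t * x)‖ := by gcongr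
        _ ≤ _ := by rw [one_mul]; exact SchwartzMap.norm_le_seminorm ℂ g (t * x))
  simpa [moment] using this

theorem mul_moment_zero {g : 𝓢(ℝ, ℂ)} (h0 : g 0 = 0) (x : ℝ) :
    (x : ℂ) * moment 0 (SchwartzMap.derivCLM ℂ ℂ g) x = g x := by
  set g' := SchwartzMap.derivCLM ℂ ℂ g with hg'
  have hc' := g'.continuous
  have h1 : ∀ t ∈ uIcc (0 : ℝ) 1, HasDerivAt (fun t : ℝ => g (t * x)) ((x : ℂ) * g' (t * x)) t := by
    intro t _
    have h1 : HasDerivAt (fun y : ℝ => y * x) x t := by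
      simpa using (hasDerivAt_id t).mul_const x
    have h2 : HasDerivAt g (g' (t * x)) (t * x) := by
      rw [hg', SchwartzMap.derivCLM_apply]
      exact g.differentiableAt.hasDerivAt
    simpa [Complex.real_smul, Function.comp_def] using h2.scomp t h1
  have h2 := intervalIntegral.integral_eq_sub_of_hasDerivAt h1
    (Continuous.intervalIntegrable (by fun_prop) _ _)
  simp only [one_mul, zero_mul, h0, sub_zero] at h2
  rw [← h2, intervalIntegral.integral_const_mul]
  simp [moment]

theorem mul_iteratedDeriv_moment {g : 𝓢(ℝ, ℂ)} (h0 : g 0 = 0) (m : ℕ) (x : ℝ) :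
    (x : ℂ) * iteratedDeriv (m + 1) (moment 0 (SchwartzMap.derivCLM ℂ ℂ g)) x
      + (m + 1) * iteratedDeriv m (moment 0 (SchwartzMap.derivCLM ℂ ℂ g)) x
      = ((SchwartzMap.derivCLM ℂ ℂ)^[m + 1] g) x := by
  set h := moment 0 (SchwartzMap.derivCLM ℂ ℂ g) with hh
  have hd : ∀ m x, HasDerivAt (iteratedDeriv m h) (iteratedDeriv (m + 1) h x) x := by
    intro m x
    rw [iteratedDeriv_succ]
    refine DifferentiableAt.hasDerivAt ?_
    rw [hh, moment_iteratedDeriv]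
    exact (moment_hasDerivAt _ _ x).differentiableAt
  have hid : ∀ x : ℝ, HasDerivAt (fun x : ℝ => (x : ℂ)) 1 x := fun x =>
    (hasDerivAt_id x).ofReal_comp
  induction m generalizing x with
  | zero =>
    have h1 := (hid x).mul (hd 0 x)
    have h2 : ((fun x : ℝ => (x : ℂ)) * iteratedDeriv 0 h) = g := by
      funext y
      simpa using mul_moment_zero h0 y
    rw [h2] at h1
    simp only [zero_add, Function.iterate_one, SchwartzMap.derivCLM_apply, h1.deriv]
    push_cast
    ring
  | succ m ih =>
    have h1 := ((hid x).mul (hd (m + 1) x)).add ((hd m x).const_mul ((m : ℂ) + 1))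
    have h2 : ((fun x : ℝ => (x : ℂ)) * iteratedDeriv (m + 1) h) +
        (fun y => ((m : ℂ) + 1) * iteratedDeriv m h y) =
        ((SchwartzMap.derivCLM ℂ ℂ)^[m + 1] g) := funext fun y => ih y
    rw [h2] at h1
    rw [Function.iterate_succ_apply', SchwartzMap.derivCLM_apply, h1.deriv]
    push_cast
    ring

/-- The even function `ψ ↦ (𝒜₁ψ)'(x) / x`, extended smoothly to `0`. -/
def divDerivFun (ψ : 𝓢(ℝ, ℂ)) : ℝ → ℂ :=
  moment 0 (SchwartzMap.derivCLM ℂ ℂ (SchwartzMap.derivCLM ℂ ℂ (avgOne ψ)))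

theorem mul_divDerivFun (ψ : 𝓢(ℝ, ℂ)) (x : ℝ) :
    (x : ℂ) * divDerivFun ψ x = deriv (avgOne ψ) x := by
  have := mul_moment_zero (g := SchwartzMap.derivCLM ℂ ℂ (avgOne ψ))
    (by rw [SchwartzMap.derivCLM_apply]; exact deriv_zero_of_even (avgOne_neg ψ)) x
  rwa [SchwartzMap.derivCLM_apply] at this

theorem divDerivFun_bound (k m : ℕ) : ∃ q : Seminorm ℂ 𝓢(ℝ, ℂ), Continuous q ∧
    ∀ (ψ : 𝓢(ℝ, ℂ)) (x : ℝ), ‖x‖ ^ k * ‖iteratedDeriv m (divDerivFun ψ) x‖ ≤ q ψ := by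
  have hpc : ∀ k n, Continuous (SchwartzMap.seminorm ℂ k n : Seminorm ℂ 𝓢(ℝ, ℂ)) := fun k n =>
    (schwartz_withSeminorms ℂ ℝ ℂ).continuous_seminorm (k, n)
  have hLc : ∀ n, ∃ L : 𝓢(ℝ, ℂ) →L[ℂ] 𝓢(ℝ, ℂ),
      ∀ ψ, L ψ = (SchwartzMap.derivCLM ℂ ℂ)^[n] ψ := by
    intro n
    refine ⟨(SchwartzMap.derivCLM ℂ ℂ) ^ n, fun ψ => ?_⟩
    exact congrFun (FunLike.coe_pow_eq_iterate (SchwartzMap.derivCLM ℂ ℂ) n) ψ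
  induction k generalizing m with
  | zero =>
    obtain ⟨L, hL⟩ := hLc m
    let M : 𝓢(ℝ, ℂ) →L[ℂ] 𝓢(ℝ, ℂ) :=
      L ∘L SchwartzMap.derivCLM ℂ ℂ ∘L SchwartzMap.derivCLM ℂ ℂ ∘L avgOne
    refine ⟨(SchwartzMap.seminorm ℂ 0 0 : Seminorm ℂ 𝓢(ℝ, ℂ)).comp M.toLinearMap,
      show Continuous fun ψ => SchwartzMap.seminorm ℂ 0 0 (M ψ) from
        (hpc 0 0).comp M.continuous,
      fun ψ x => ?_⟩
    rw [pow_zero, one_mul, divDerivFun, moment_iteratedDeriv, ← hL]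
    exact moment_norm_le _ _ x
  | succ k ih =>
    cases m with
    | zero =>
      let M : 𝓢(ℝ, ℂ) →L[ℂ] 𝓢(ℝ, ℂ) := SchwartzMap.derivCLM ℂ ℂ ∘L avgOne
      refine ⟨(SchwartzMap.seminorm ℂ k 0 : Seminorm ℂ 𝓢(ℝ, ℂ)).comp M.toLinearMap,
      show Continuous fun ψ => SchwartzMap.seminorm ℂ k 0 (M ψ) from
        (hpc k 0).comp M.continuous,
        fun ψ x => ?_⟩
      have h1 := mul_divDerivFun ψ x
      have h2 : ‖x‖ * ‖divDerivFun ψ x‖ = ‖M ψ x‖ := by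
        rw [← Complex.norm_real x, ← norm_mul, h1]
        rfl
      rw [iteratedDeriv_zero, pow_succ, mul_assoc, h2]
      simpa using SchwartzMap.le_seminorm' ℂ k 0 (M ψ) x
    | succ m =>
      obtain ⟨q, hq, hqb⟩ := ih m
      obtain ⟨L, hL⟩ := hLc (m + 1)
      let M : 𝓢(ℝ, ℂ) →L[ℂ] 𝓢(ℝ, ℂ) := L ∘L SchwartzMap.derivCLM ℂ ℂ ∘L avgOne
      refine ⟨(SchwartzMap.seminorm ℂ k 0).comp M.toLinearMap + (m + 1) • q, ?_, fun ψ x => ?_⟩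
      · exact ((hpc k 0).comp M.continuous).add (hq.const_smul (m + 1))
      · have h1 := mul_iteratedDeriv_moment (g := SchwartzMap.derivCLM ℂ ℂ (avgOne ψ))
          (by rw [SchwartzMap.derivCLM_apply]; exact deriv_zero_of_even (avgOne_neg ψ)) m x
        rw [← hL] at h1
        have h2 : ‖x‖ * ‖iteratedDeriv (m + 1) (divDerivFun ψ) x‖
            ≤ ‖M ψ x‖ + (m + 1) * ‖iteratedDeriv m (divDerivFun ψ) x‖ := by
          rw [← Complex.norm_real x, ← norm_mul]
          have h3 : (x : ℂ) * iteratedDeriv (m + 1) (divDerivFun ψ) x =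
              M ψ x - (m + 1) * iteratedDeriv m (divDerivFun ψ) x :=
            eq_sub_of_add_eq h1
          rw [h3]
          refine (norm_sub_le _ _).trans (le_of_eq ?_)
          rw [norm_mul]
          congr 2
          exact_mod_cast Complex.norm_natCast (m + 1)
        have h4 : ‖x‖ ^ k * ‖M ψ x‖ ≤ SchwartzMap.seminorm ℂ k 0 (M ψ) := by
          simpa using SchwartzMap.le_seminorm' ℂ k 0 (M ψ) x
        have h5 := hqb ψ x
        have h6 : ((SchwartzMap.seminorm ℂ k 0).comp M.toLinearMap + (m + 1) • q) ψ =
            SchwartzMap.seminorm ℂ k 0 (M ψ) + (m + 1) * q ψ := by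
          simp [add_apply, smul_apply, nsmul_eq_mul]
        rw [h6, pow_succ, mul_assoc]
        calc ‖x‖ ^ k * (‖x‖ * ‖iteratedDeriv (m + 1) (divDerivFun ψ) x‖)
            ≤ ‖x‖ ^ k * (‖M ψ x‖ + (m + 1) * ‖iteratedDeriv m (divDerivFun ψ) x‖) := by gcongr
          _ = ‖x‖ ^ k * ‖M ψ x‖ +
                (m + 1) * (‖x‖ ^ k * ‖iteratedDeriv m (divDerivFun ψ) x‖) := by ring
          _ ≤ _ := by gcongr

theorem exists_sup_bound {q : Seminorm ℂ 𝓢(ℝ, ℂ)} (hq : Continuous q) :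
    ∃ (s : Finset (ℕ × ℕ)) (C : ℝ), 0 ≤ C ∧
      ∀ ψ, q ψ ≤ C * s.sup (schwartzSeminormFamily ℂ ℝ ℂ) ψ := by
  obtain ⟨s, C, -, h⟩ := Seminorm.bound_of_continuous (schwartz_withSeminorms ℂ ℝ ℂ) q hq
  exact ⟨s, C, C.2, fun ψ => h ψ⟩

/-- The operator `ψ ↦ (𝒜₁ψ)'(x) / x` on Schwartz functions. -/
def divDeriv : 𝓢(ℝ, ℂ) →L[ℂ] 𝓢(ℝ, ℂ) :=
  SchwartzMap.mkCLM (σ := RingHom.id ℂ) divDerivFun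
    (fun f g x => by
      have := (SchwartzMap.derivCLM ℂ ℂ
        (SchwartzMap.derivCLM ℂ ℂ (avgOne f))).continuous
      have := (SchwartzMap.derivCLM ℂ ℂ
        (SchwartzMap.derivCLM ℂ ℂ (avgOne g))).continuous
      simp only [divDerivFun, moment, map_add, add_apply, mul_add]
      exact intervalIntegral.integral_add (Continuous.intervalIntegrable (by fun_prop) _ _)
        (Continuous.intervalIntegrable (by fun_prop) _ _))
    (fun a f x => by
      simp only [divDerivFun, moment, map_smul, smul_apply, smul_eq_mul,
        mul_left_comm _ a, RingHom.id_apply]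
      exact intervalIntegral.integral_const_mul a _)
    (fun f => moment_contDiff _ _)
    (fun n => by
      obtain ⟨q, hq, hqb⟩ := divDerivFun_bound n.1 n.2
      obtain ⟨s, C, hC, h⟩ := exists_sup_bound hq
      refine ⟨s, C, hC, fun ψ x => ?_⟩
      rw [norm_iteratedFDeriv_eq_norm_iteratedDeriv]
      exact (hqb ψ x).trans (h ψ))

theorem mul_divDeriv (ψ : 𝓢(ℝ, ℂ)) (x : ℝ) :
    (x : ℂ) * divDeriv ψ x = deriv (avgOne ψ) x := mul_divDerivFun ψ x

theorem divDeriv_neg (ψ : 𝓢(ℝ, ℂ)) (x : ℝ) : divDeriv ψ (-x) = divDeriv ψ x := by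
  rcases eq_or_ne x 0 with rfl | hx
  · simp
  · have h1 := mul_divDeriv ψ x
    have h2 := mul_divDeriv ψ (-x)
    have h3 : deriv (avgOne ψ) (-x) = -deriv (avgOne ψ) x := by
      have := deriv_comp_neg (f := avgOne ψ) x
      rw [funext (avgOne_neg ψ)] at this
      rw [this, neg_neg]
    rw [h3, ← h1] at h2
    have hx' : (x : ℂ) ≠ 0 := by exact_mod_cast hx
    push_cast at h2
    refine mul_left_cancel₀ hx' ?_
    linear_combination -h2

section Rotation

variable {E : Type*} [NormedAddCommGroup E] [InnerProductSpace ℝ E]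

variable (E) in
/-- `x ↦ ⟪x, ·⟫` as a complex-valued functional. -/
def innerC : E →L[ℝ] (E →L[ℝ] ℂ) :=
  (ContinuousLinearMap.compL ℝ E ℝ ℂ Complex.ofRealCLM) ∘L (innerSL ℝ)

theorem innerC_apply (x y : E) : innerC E x y = ((⟪x, y⟫_ℝ : ℝ) : ℂ) := rfl

theorem hasFDerivAt_rot (ψ : 𝓢(ℝ, ℂ)) (x : E) :
    HasFDerivAt (fun x : E => avgOne ψ ‖x‖) (avgOne (divDeriv ψ) ‖x‖ • innerC E x) x := by
  rw [avgOne_of_even (divDeriv_neg ψ)]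
  have hd : HasDerivAt (avgOne ψ) (deriv (avgOne ψ) ‖x‖) ‖x‖ :=
    (avgOne ψ).differentiableAt.hasDerivAt
  rcases eq_or_ne x 0 with rfl | hx
  · rw [norm_zero, deriv_zero_of_even (avgOne_neg ψ)] at hd
    have h0 : divDeriv ψ ‖(0 : E)‖ • innerC E 0 = 0 := by
      ext y
      simp
    rw [h0, hasFDerivAt_iff_isLittleO_nhds_zero]
    have h1 := (hasDerivAt_iff_isLittleO_nhds_zero.1 hd).comp_tendsto
      (k := fun h : E => ‖h‖) (l' := 𝓝 0) (by simpa using (continuous_norm (E := E)).tendsto 0)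
    simpa [Function.comp_def] using Asymptotics.isLittleO_norm_right.1 h1
  · have hn : HasFDerivAt (fun x : E => ‖x‖) (‖x‖⁻¹ • innerSL ℝ x) x := by
      have h1 := (hasStrictFDerivAt_norm_sq x).hasFDerivAt.sqrt (by positivity)
      simp only [Real.sqrt_sq (norm_nonneg _)] at h1
      refine h1.congr_fderiv ?_
      ext y
      simp only [smul_apply, smul_eq_mul, nsmul_eq_mul]
      field_simp
      simp
    refine (hd.hasFDerivAt.comp x hn).congr_fderiv ?_
    ext y
    have h2 := mul_divDeriv ψ ‖x‖
    have hx' : (‖x‖ : ℂ) ≠ 0 := by exact_mod_cast norm_ne_zero_iff.2 hx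
    simp only [ContinuousLinearMap.comp_apply, smul_apply, innerC_apply,
      ContinuousLinearMap.toSpanSingleton_apply, smul_eq_mul, Complex.real_smul, ← h2,
      innerSL_apply_apply]
    push_cast
    field_simp

theorem fderiv_rot (ψ : 𝓢(ℝ, ℂ)) :
    fderiv ℝ (fun x : E => avgOne ψ ‖x‖) =
      fun x => (avgOne (divDeriv ψ) ‖x‖) • innerC E x :=
  funext fun x => (hasFDerivAt_rot ψ x).fderiv

theorem contDiff_rot_nat (n : ℕ) (ψ : 𝓢(ℝ, ℂ)) :
    ContDiff ℝ n (fun x : E => avgOne ψ ‖x‖) := by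
  induction n generalizing ψ with
  | zero =>
    have := (avgOne ψ).continuous
    exact contDiff_zero.2 (by fun_prop)
  | succ n ih =>
    push_cast
    rw [contDiff_succ_iff_fderiv]
    refine ⟨fun x => (hasFDerivAt_rot ψ x).differentiableAt, by simp, ?_⟩
    rw [fderiv_rot]
    exact (ih (divDeriv ψ)).smul (innerC E).contDiff

theorem contDiff_rot (ψ : 𝓢(ℝ, ℂ)) : ContDiff ℝ ∞ (fun x : E => avgOne ψ ‖x‖) :=
  contDiff_infty.2 fun n => contDiff_rot_nat n ψ

theorem rot_bound (n k : ℕ) : ∃ q : Seminorm ℂ 𝓢(ℝ, ℂ), Continuous q ∧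
    ∀ (ψ : 𝓢(ℝ, ℂ)) (x : E),
      (1 + ‖x‖) ^ k * ‖iteratedFDeriv ℝ n (fun x : E => avgOne ψ ‖x‖) x‖ ≤ q ψ := by
  induction n using Nat.strong_induction_on generalizing k with
  | _ n ih =>
  cases n with
  | zero =>
    refine ⟨(2 ^ k : ℕ) • ((Finset.Iic (k, 0)).sup (schwartzSeminormFamily ℂ ℝ ℂ)).comp
      avgOne.toLinearMap, ?_, fun ψ x => ?_⟩
    · have h1 : Continuous ((Finset.Iic (k, 0)).sup (schwartzSeminormFamily ℂ ℝ ℂ) :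
          Seminorm ℂ 𝓢(ℝ, ℂ)) :=
        Seminorm.continuous_finsetSup fun i _ =>
          (schwartz_withSeminorms ℂ ℝ ℂ).continuous_seminorm i
      exact (h1.comp avgOne.continuous).const_smul (2 ^ k : ℕ)
    · have := SchwartzMap.one_add_le_sup_seminorm_apply (𝕜 := ℂ) (m := (k, 0)) (k := k) (n := 0)
        le_rfl le_rfl (avgOne ψ) ‖x‖
      rw [norm_iteratedFDeriv_zero, norm_norm] at this
      rw [norm_iteratedFDeriv_zero]
      refine this.trans (le_of_eq ?_)
      simp only [smul_apply, Seminorm.comp_apply, nsmul_eq_mul]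
      push_cast
      rfl
  | succ n =>
    obtain ⟨l, C, hC, hL⟩ :=
      (innerC E).hasTemperateGrowth.norm_iteratedFDeriv_le_uniform n
    have hi : ∀ i, ∃ q : Seminorm ℂ 𝓢(ℝ, ℂ), Continuous q ∧ (i < n + 1 →
        ∀ (ψ : 𝓢(ℝ, ℂ)) (x : E),
        (1 + ‖x‖) ^ (k + l) * ‖iteratedFDeriv ℝ i (fun x : E => avgOne ψ ‖x‖) x‖ ≤ q ψ) := by
      intro i
      by_cases h : i < n + 1
      · obtain ⟨q, hq, hb⟩ := ih i h (k + l)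
        exact ⟨q, hq, fun _ => hb⟩
      · exact ⟨0, continuous_const, fun h' => absurd h' h⟩
    choose q hq hqb using hi
    let C' : ℝ≥0 := ⟨C, hC⟩
    refine ⟨∑ i ∈ Finset.range (n + 1), ((n.choose i : ℝ≥0) * C') •
      (q i).comp divDeriv.toLinearMap, ?_, fun ψ x => ?_⟩
    · exact Seminorm.continuous_finsetSum fun i _ =>
        ((hq i).comp divDeriv.continuous).const_smul ((n.choose i : ℝ≥0) * C')
    · rw [← norm_iteratedFDeriv_fderiv, fderiv_rot]
      have hs : (∑ i ∈ Finset.range (n + 1), ((n.choose i : ℝ≥0) * C') •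
          (q i).comp divDeriv.toLinearMap) ψ = ∑ i ∈ Finset.range (n + 1),
            ((n.choose i : ℝ≥0) * C') • q i (divDeriv ψ) := by
        simp
      rw [hs]
      have h1 := norm_iteratedFDeriv_smul_le (𝕜 := ℝ) (n := n)
        (contDiff_rot_nat (E := E) n (divDeriv ψ)) (innerC E).contDiff x le_rfl
      calc (1 + ‖x‖) ^ k * _ ≤ (1 + ‖x‖) ^ k * _ := mul_le_mul_of_nonneg_left h1 (by positivity)
        _ ≤ _ := by
          rw [Finset.mul_sum]
          refine Finset.sum_le_sum fun i hi => ?_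
          have hi' := Finset.mem_range.1 hi
          have h2 := hL (n - i) (Nat.sub_le _ _) x
          have h3 := hqb i hi' (divDeriv ψ) x
          calc (1 + ‖x‖) ^ k * ((n.choose i : ℝ) *
                ‖iteratedFDeriv ℝ i (fun x : E => avgOne (divDeriv ψ) ‖x‖) x‖ *
                ‖iteratedFDeriv ℝ (n - i) (innerC E) x‖)
              ≤ (1 + ‖x‖) ^ k * ((n.choose i : ℝ) *
                ‖iteratedFDeriv ℝ i (fun x : E => avgOne (divDeriv ψ) ‖x‖) x‖ *
                (C * (1 + ‖x‖) ^ l)) := by gcongr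
            _ = (n.choose i : ℝ) * C * ((1 + ‖x‖) ^ (k + l) *
                ‖iteratedFDeriv ℝ i (fun x : E => avgOne (divDeriv ψ) ‖x‖) x‖) := by ring
            _ ≤ (n.choose i : ℝ) * C * q i (divDeriv ψ) := by gcongr
            _ = _ := by
              simp only [NNReal.smul_def, NNReal.coe_mul, NNReal.coe_natCast, smul_eq_mul]
              rfl

variable (E) in
/-- The operator `ℛ ∘ 𝒜₁ : 𝓢(ℝ) → 𝓢(E)`, i.e. `(ℛ (𝒜₁ ψ)) x = (𝒜₁ ψ) ‖x‖`. -/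
def rotAvg : 𝓢(ℝ, ℂ) →L[ℂ] 𝓢(E, ℂ) :=
  SchwartzMap.mkCLM (σ := RingHom.id ℂ) (fun ψ x => avgOne ψ ‖x‖)
    (fun f g x => by simp) (fun a f x => by simp) contDiff_rot
    (fun n => by
      obtain ⟨q, hq, hqb⟩ := rot_bound (E := E) n.2 n.1
      obtain ⟨s, C, hC, h⟩ := exists_sup_bound hq
      refine ⟨s, C, hC, fun ψ x => ?_⟩
      refine le_trans ?_ ((hqb ψ x).trans (h ψ))
      gcongr
      simp)

theorem rotAvg_apply (ψ : 𝓢(ℝ, ℂ)) (x : E) : rotAvg E ψ x = (ψ ‖x‖ + ψ (-‖x‖)) / 2 :=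
  avgOne_apply ψ ‖x‖

end Rotation

/-! ### The slicing operator on tempered distributions -/

/-- The rotation operator `ℛ_d F = F ∘ ‖·‖` for `F : [0, ∞) → ℝ`, viewed as a complex-valued
function on `ℝ^d`. -/
def rotationOp (d : ℕ) (F : ℝ≥0 → ℝ) (x : EuclideanSpace ℝ (Fin d)) : ℂ := (F ‖x‖₊ : ℂ)

/-- The operator `ℛ_d^⋆ : 𝓢'(ℝ^d) → 𝓢'(ℝ)`, `⟨ℛ_d^⋆ T, ψ⟩ = ⟨T, (ℛ_d ∘ 𝒜₁) ψ⟩`. -/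
def rotStar (d : ℕ) :
    𝓢'(EuclideanSpace ℝ (Fin d), ℂ) →L[ℂ] 𝓢'(ℝ, ℂ) :=
  PointwiseConvergenceCLM.precomp ℂ (rotAvg (EuclideanSpace ℝ (Fin d)))

theorem rotStar_apply (d : ℕ) (T : 𝓢'(EuclideanSpace ℝ (Fin d), ℂ)) (ψ : 𝓢(ℝ, ℂ)) :
    rotStar d T ψ = T (rotAvg (EuclideanSpace ℝ (Fin d)) ψ) := rfl

/-- The distributional slicing operator `ℱ₁ ∘ ℛ_d^⋆ ∘ ℱ_d⁻¹`. -/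
def slicingOperator (d : ℕ) (T : 𝓢'(EuclideanSpace ℝ (Fin d), ℂ)) : 𝓢'(ℝ, ℂ) :=
  𝓕 (rotStar d (𝓕⁻ T))

/-- The uniform distribution on the unit sphere of `ℝ^d`: normalized surface measure. -/
def uniformSphere (d : ℕ) : Measure (sphere (0 : EuclideanSpace ℝ (Fin d)) 1) :=
  ((volume : Measure (EuclideanSpace ℝ (Fin d))).toSphere univ)⁻¹ •
    (volume : Measure (EuclideanSpace ℝ (Fin d))).toSphere

end Slicing

end

/-! The hypothesis is tested against radial functions. For a radial Schwartz function `η` on ℝ^d put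
g(t) = 𝓕η(t e₀), the restriction of 𝓕η to a line. Since 𝓕η is radial, rotating g gives 𝓕η back, so
the sliced distribution paired with 𝓕⁻g is ⟨T, η⟩. By the Fourier slice theorem 𝓕⁻g is also the
marginal of `η`, its integral over parallel hyperplanes. Fubini then turns ∫ f 𝓕⁻g into the integral
of `η` against the ridge function x ↦ f(⟨e, x⟩), for any unit vector e
(`apply_radial_eq_integral_ridge`).

Because `η` is radial, polar coordinates allow the ridge function to be replaced by its spherical
mean H(‖x‖), where H(r) = E f(r⟨e, ξ⟩) (`integral_ridge_mul_radial`). When T is generated by F(‖x‖),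
the difference F − H therefore annihilates every compactly supported radial test function, and
concentrating such functions near the sphere through z forces F = H at ‖z‖
(`radial_eq_zero_of_integral_eq_zero`). The absolute value in the formula is harmless because `f` is
even (`even_of_slicingOperator_eq`). -/

namespace Slicing

/-! ### Uniqueness of densities and evenness of the slice -/

/-- Two locally integrable functions on `ℝ` with the same integrals against all Schwartz functions
agree almost everywhere. -/
theorem ae_eq_of_integral_schwartz_eq {u v : ℝ → ℂ} (hu : LocallyIntegrable u)
    (hv : LocallyIntegrable v)
    (h : ∀ φ : 𝓢(ℝ, ℂ), ∫ t, u t * φ t = ∫ t, v t * φ t) : u =ᵐ[volume] v := by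
  refine ae_eq_of_integral_contDiff_smul_eq hu hv fun g hg hgs => ?_
  have : ∫ t, u t * (g t : ℂ) = ∫ t, v t * (g t : ℂ) := h ((hgs.comp_left (g := ((↑) : ℝ → ℂ)) Complex.ofReal_zero).toSchwartzMap
    (Complex.ofRealCLM.contDiff.comp hg))
  simpa [mul_comm] using this

theorem slicingOperator_apply (d : ℕ) (T : 𝓢'(EuclideanSpace ℝ (Fin d), ℂ)) (ψ : 𝓢(ℝ, ℂ)) :
    slicingOperator d T ψ = T (𝓕⁻ (rotAvg (EuclideanSpace ℝ (Fin d)) (𝓕 ψ))) := rfl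

/-- A continuous function generating a distribution in the range of the slicing operator is
even. -/
theorem even_of_slicingOperator_eq {d : ℕ} {T : 𝓢'(EuclideanSpace ℝ (Fin d), ℂ)} {f : ℝ → ℂ}
    (hf : SlowlyIncreasing f) (hT : slicingOperator d T = hf.toDistribution)
    (hfc : Continuous f) (t : ℝ) : f (-t) = f t := by
  have hc : Continuous fun t => f (-t) := by fun_prop
  refine congrFun ((hc.ae_eq_iff_eq volume hfc).1 ?_) t
  refine ae_eq_of_integral_schwartz_eq hc.locallyIntegrable hf.1 fun φ => ?_
  -- Reflecting the test function reflects its Fourier transform, and `rotAvg` sees only the even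
  -- part, so the sliced distribution cannot tell `φ'` from `φ`.
  set φ' : 𝓢(ℝ, ℂ) :=
    SchwartzMap.compCLMOfContinuousLinearEquiv ℂ (ContinuousLinearEquiv.neg ℝ) φ with hφ'
  have h1 : ∀ r, 𝓕 φ' r = 𝓕 φ (-r) := fun r =>
    Real.fourier_comp_linearIsometry (LinearIsometryEquiv.neg ℝ (E := ℝ)) φ r
  have h2 : rotAvg (EuclideanSpace ℝ (Fin d)) (𝓕 φ') = rotAvg _ (𝓕 φ) := by
    ext x
    rw [rotAvg_apply, rotAvg_apply, h1, h1, neg_neg, add_comm]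
  have h3 : hf.toDistribution φ' = hf.toDistribution φ := by
    rw [← hT, slicingOperator_apply, slicingOperator_apply, h2]
  rw [hf.toDistribution_apply, hf.toDistribution_apply] at h3
  rw [← h3, ← integral_neg_eq_self]
  simp [hφ']

/-! ### Hyperplane integrals and the Fourier slice theorem -/

section Marginal

variable {n : ℕ}

/-- The identification `ℝ × ℝⁿ ≃ ℝⁿ⁺¹` splitting off the first coordinate. -/
noncomputable def consEquiv (n : ℕ) :
    ℝ × (Fin n → ℝ) ≃ᵐ EuclideanSpace ℝ (Fin (n + 1)) :=
  (MeasurableEquiv.piFinSuccAbove (fun _ : Fin (n + 1) => ℝ) 0).symm.trans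
    (MeasurableEquiv.toLp 2 (Fin (n + 1) → ℝ))

theorem consEquiv_apply_zero (p : ℝ × (Fin n → ℝ)) : consEquiv n p 0 = p.1 := by
  simp [consEquiv, MeasurableEquiv.piFinSuccAbove]

theorem measurePreserving_consEquiv : MeasurePreserving (consEquiv n) :=
  (PiLp.volume_preserving_toLp (Fin (n + 1))).comp
    (volume_preserving_piFinSuccAbove (fun _ : Fin (n + 1) => ℝ) 0).symm

/-- The integral of `η` over the hyperplane on which the first coordinate is `s`. -/
noncomputable def marginal (η : EuclideanSpace ℝ (Fin (n + 1)) → ℂ) (s : ℝ) : ℂ :=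
  ∫ y : Fin n → ℝ, η (consEquiv n (s, y))

theorem integrable_marginal {η : EuclideanSpace ℝ (Fin (n + 1)) → ℂ} (hη : Integrable η) :
    Integrable (marginal η) :=
  ((measurePreserving_consEquiv.integrable_comp_emb
    (consEquiv n).measurableEmbedding).2 hη).integral_prod_left

theorem integral_mul_marginal {η : EuclideanSpace ℝ (Fin (n + 1)) → ℂ} {h : ℝ → ℂ}
    (hi : Integrable fun x => h (x 0) * η x) :
    ∫ x, h (x 0) * η x = ∫ s, h s * marginal η s := by
  have h1 := (measurePreserving_consEquiv.integrable_comp_emb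
    (consEquiv n).measurableEmbedding).2 hi
  rw [← measurePreserving_consEquiv.integral_comp (consEquiv n).measurableEmbedding]
  refine (integral_prod _ h1).trans ?_
  simp only [Function.comp_apply, consEquiv_apply_zero, integral_const_mul, marginal]

/-- The Fourier slice theorem. -/
theorem fourier_marginal {η : EuclideanSpace ℝ (Fin (n + 1)) → ℂ} (hη : Integrable η) (t : ℝ) :
    𝓕 (marginal η) t = 𝓕 η (t • EuclideanSpace.single 0 1) := by
  rw [Real.fourier_eq, Real.fourier_eq]
  have h1 : ∀ x : EuclideanSpace ℝ (Fin (n + 1)),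
      ⟪x, t • EuclideanSpace.single 0 (1 : ℝ)⟫_ℝ = ⟪x 0, t⟫_ℝ := by
    intro x
    simp [inner_smul_right, EuclideanSpace.inner_single_right]
  simp only [h1, Circle.smul_def, smul_eq_mul]
  refine (integral_mul_marginal (h := fun s => (Real.fourierChar (-⟪s, t⟫_ℝ) : ℂ)) ?_).symm
  refine hη.bdd_mul (c := 1) (Continuous.aestronglyMeasurable ?_)
    (Eventually.of_forall fun x => (Circle.norm_coe _).le)
  exact continuous_subtype_val.comp (Real.continuous_fourierChar.comp (by fun_prop))

/-- Injectivity of the Fourier transform, by duality: the marginal is only known to be integrable,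
so the transform is moved onto a Schwartz test function instead of being inverted. -/
theorem marginal_ae_eq {η : EuclideanSpace ℝ (Fin (n + 1)) → ℂ} (hη : Integrable η) {ψ : 𝓢(ℝ, ℂ)}
    (h : ∀ t, 𝓕 ψ t = 𝓕 η (t • EuclideanSpace.single 0 1)) :
    marginal η =ᵐ[volume] ψ := by
  refine ae_eq_of_integral_schwartz_eq (integrable_marginal hη).locallyIntegrable
    ψ.integrable.locallyIntegrable fun φ => ?_
  -- Every Schwartz function is a Fourier transform, so testing against `𝓕 k` loses nothing.
  obtain ⟨k, rfl⟩ : ∃ k : 𝓢(ℝ, ℂ), 𝓕 k = φ := ⟨𝓕⁻ φ, FourierTransform.fourier_fourierInv_eq φ⟩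
  have h1 : ∫ ξ, 𝓕 k ξ • marginal η ξ = ∫ x, k x • 𝓕 (marginal η) x := by
    simpa using! VectorFourier.integral_fourierIntegral_smul_eq_flip (L := innerₗ ℝ)
      Real.continuous_fourierChar continuous_inner k.integrable (integrable_marginal hη)
  have h2 := SchwartzMap.integral_fourier_smul_eq k ψ
  simp only [fourier_marginal hη, ← h] at h1
  rw [← h2] at h1
  simpa [mul_comm] using h1

end Marginal

/-! ### Radial functions under the Fourier transform and the slicing operator -/

/-- The reflection in the hyperplane orthogonal to v − w exchanges two vectors of equal norm. -/
theorem exists_linearIsometryEquiv_apply_eq {E : Type*} [NormedAddCommGroup E]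
    [InnerProductSpace ℝ E] [FiniteDimensional ℝ E] {v w : E} (h : ‖v‖ = ‖w‖) :
    ∃ A : E ≃ₗᵢ[ℝ] E, A v = w :=
  ⟨_, Submodule.reflection_sub h⟩

/-- The Fourier transform commutes with linear isometries, and these act transitively on spheres. -/
theorem fourier_radial {E : Type*} [NormedAddCommGroup E] [InnerProductSpace ℝ E]
    [FiniteDimensional ℝ E] [MeasurableSpace E] [BorelSpace E] {η : E → ℂ}
    (hη : ∀ x y, ‖x‖ = ‖y‖ → η x = η y) {v w : E} (h : ‖v‖ = ‖w‖) : 𝓕 η v = 𝓕 η w := by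
  obtain ⟨A, rfl⟩ := exists_linearIsometryEquiv_apply_eq h
  rw [← Real.fourier_comp_linearIsometry]
  have h1 : η ∘ A = η := funext fun x => hη _ _ (A.norm_map x)
  rw [h1]

/-- Tested against a radial function, `T` agrees with the ridge function generated by its slice. -/
theorem apply_radial_eq_integral_ridge {n : ℕ} {T : 𝓢'(EuclideanSpace ℝ (Fin (n + 1)), ℂ)}
    {f : ℝ → ℂ} (hf : SlowlyIncreasing f)
    (hT : slicingOperator (n + 1) T = hf.toDistribution)
    (hfc : Continuous f) (η : 𝓢(EuclideanSpace ℝ (Fin (n + 1)), ℂ)) (hηc : HasCompactSupport η)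
    (hη : ∀ x y, ‖x‖ = ‖y‖ → η x = η y) {e : EuclideanSpace ℝ (Fin (n + 1))} (he : ‖e‖ = 1) :
    T η = ∫ x, f ⟪e, x⟫_ℝ * η x := by
  set e₀ : EuclideanSpace ℝ (Fin (n + 1)) := EuclideanSpace.single 0 1 with he₀
  have hn : ‖e₀‖ = 1 := by simp [he₀]
  have hiso : Isometry fun t : ℝ => t • e₀ := by
    refine Isometry.of_dist_eq fun s t => ?_
    rw [dist_eq_norm, ← sub_smul, norm_smul, hn, mul_one, dist_eq_norm]
  set g : 𝓢(ℝ, ℂ) := SchwartzMap.compCLMOfAntilipschitz ℂ (g := fun t : ℝ => t • e₀)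
    ((ContinuousLinearMap.toSpanSingleton ℝ e₀).hasTemperateGrowth) hiso.antilipschitz (𝓕 η)
    with hg
  have hgt : ∀ t, g t = 𝓕 (η : _ → ℂ) (t • e₀) := fun t => rfl
  have hrot : rotAvg (EuclideanSpace ℝ (Fin (n + 1))) g = 𝓕 η := by
    ext x
    rw [rotAvg_apply, hgt, hgt, SchwartzMap.fourier_coe,
      fourier_radial hη (v := ‖x‖ • e₀) (w := x) (by simp [norm_smul, hn]),
      fourier_radial hη (v := (-‖x‖) • e₀) (w := x) (by simp [norm_smul, hn])]
    ring
  -- With the test function `𝓕⁻ g` both Fourier transforms cancel and the left side becomes `T η`.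
  have h1 := congrArg (fun S : 𝓢'(ℝ, ℂ) => S (𝓕⁻ g)) hT
  simp only [slicingOperator_apply, FourierTransform.fourier_fourierInv_eq, hrot,
    FourierTransform.fourierInv_fourier_eq, hf.toDistribution_apply] at h1
  have hm : marginal η =ᵐ[volume] (𝓕⁻ g : 𝓢(ℝ, ℂ)) := by
    refine marginal_ae_eq η.integrable fun t => ?_
    rw [FourierTransform.fourier_fourierInv_eq]
    exact hgt t
  have h2 : ∫ x, f (x 0) * η x = ∫ s, f s * marginal η s := by
    refine integral_mul_marginal (Continuous.integrable_of_hasCompactSupport ?_ hηc.mul_left)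
    have := η.continuous
    fun_prop
  obtain ⟨A, hA⟩ := exists_linearIsometryEquiv_apply_eq (he.trans hn.symm)
  -- An isometry taking `e` to `e₀` preserves both Lebesgue measure and `η`, so the direction of the
  -- ridge is immaterial.
  have h3 : ∫ x, f ⟪e, x⟫_ℝ * η x = ∫ x, f (x 0) * η x := by
    rw [← A.measurePreserving.integral_comp A.toHomeomorph.measurableEmbedding
      (fun x => f (x 0) * η x)]
    refine integral_congr_ae (Eventually.of_forall fun x => ?_)
    have h4 : A x 0 = ⟪e, x⟫_ℝ := by
      rw [← A.inner_map_map, hA]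
      simp [he₀, EuclideanSpace.inner_single_left]
    simp only [h4, hη (A x) x (A.norm_map x)]
  rw [h1, h3, h2]
  refine integral_congr_ae ?_
  filter_upwards [hm] with s hs
  rw [hs]

/-! ### Polar coordinates and spherical means -/

theorem integral_eq_integral_sphere_prod {E : Type*} [NormedAddCommGroup E] [NormedSpace ℝ E]
    [FiniteDimensional ℝ E] [Nontrivial E] [MeasurableSpace E] [BorelSpace E] (μ : Measure E)
    [μ.IsAddHaarMeasure] (Φ : E → ℂ) :
    ∫ x, Φ x ∂μ = ∫ p : sphere (0 : E) 1 × Ioi (0 : ℝ), Φ ((p.2 : ℝ) • (p.1 : E))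
      ∂μ.toSphere.prod (Measure.volumeIoiPow (Module.finrank ℝ E - 1)) := by
  rw [← μ.measurePreserving_homeomorphUnitSphereProd.integral_comp
    (Homeomorph.measurableEmbedding _)]
  -- The polar homeomorphism lives on the punctured space; the origin is a null set.
  conv_lhs => rw [← restrict_compl_singleton (μ := μ) 0,
    ← integral_subtype_comap (measurableSet_singleton (0 : E)).compl Φ]
  refine integral_congr_ae (Eventually.of_forall fun x => ?_)
  have hx : ‖(x : E)‖ ≠ 0 := norm_ne_zero_iff.2 x.2
  simp [smul_smul, hx]

theorem integrable_sphere_prod {E : Type*} [NormedAddCommGroup E] [NormedSpace ℝ E]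
    [FiniteDimensional ℝ E] [Nontrivial E] [MeasurableSpace E] [BorelSpace E] {μ : Measure E}
    [μ.IsAddHaarMeasure] {Φ : E → ℂ} (hΦ : Integrable Φ μ) :
    Integrable (fun p : sphere (0 : E) 1 × Ioi (0 : ℝ) => Φ ((p.2 : ℝ) • (p.1 : E)))
      (μ.toSphere.prod (Measure.volumeIoiPow (Module.finrank ℝ E - 1))) := by
  rw [← μ.measurePreserving_homeomorphUnitSphereProd.integrable_comp_emb
      (Homeomorph.measurableEmbedding _)]
  rw [← restrict_compl_singleton (μ := μ) 0, ← IntegrableOn,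
    integrableOn_iff_comap_subtypeVal (measurableSet_singleton _).compl] at hΦ
  refine hΦ.congr (Eventually.of_forall fun x => ?_)
  have hx : ‖(x : E)‖ ≠ 0 := norm_ne_zero_iff.2 x.2
  simp [smul_smul, hx]

theorem integral_uniformSphere (d : ℕ) (g : sphere (0 : EuclideanSpace ℝ (Fin d)) 1 → ℂ) :
    ∫ ξ, g ξ ∂uniformSphere d =
      ((volume : Measure (EuclideanSpace ℝ (Fin d))).toSphere.real univ)⁻¹ •
        ∫ ξ, g ξ ∂(volume : Measure (EuclideanSpace ℝ (Fin d))).toSphere := by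
  rw [uniformSphere, integral_smul_measure, ENNReal.toReal_inv]
  rfl

/-- In polar coordinates the spherical mean depends on the radius alone, so integrating it over the
sphere only contributes the total mass, which cancels the normalization of `uniformSphere`. -/
theorem integral_eq_integral_uniformSphere {d : ℕ} (hd : 1 ≤ d)
    {Φ : EuclideanSpace ℝ (Fin d) → ℂ} (hΦ : Integrable Φ) :
    ∫ x, Φ x = ∫ x : EuclideanSpace ℝ (Fin d), ∫ ξ, Φ (‖x‖ • ξ.1) ∂uniformSphere d := by
  have : NeZero d := ⟨by omega⟩
  have hσ : (volume : Measure (EuclideanSpace ℝ (Fin d))).toSphere.real univ ≠ 0 := by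
    rw [Measure.real, ENNReal.toReal_ne_zero]
    exact ⟨Measure.measure_univ_ne_zero.2 (Measure.toSphere_ne_zero _), measure_ne_top _ _⟩
  rw [integral_eq_integral_sphere_prod, integral_prod_symm _ (integrable_sphere_prod hΦ),
    integral_eq_integral_sphere_prod volume
      (fun x : EuclideanSpace ℝ (Fin d) => ∫ ξ, Φ (‖x‖ • ξ.1) ∂uniformSphere d)]
  have h1 : ∀ p : sphere (0 : EuclideanSpace ℝ (Fin d)) 1 × Ioi (0 : ℝ),
      ‖(p.2 : ℝ) • (p.1 : EuclideanSpace ℝ (Fin d))‖ = p.2 := fun p => by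
    have := p.2.2.out
    simp [norm_smul, abs_of_pos this]
  simp only [h1, integral_uniformSphere, integral_smul]
  rw [integral_fun_snd (fun r : Ioi (0 : ℝ) => ∫ ξ, Φ ((r : ℝ) • ξ.1)
    ∂(volume : Measure (EuclideanSpace ℝ (Fin d))).toSphere), smul_smul, inv_mul_cancel₀ hσ,
    one_smul]

theorem continuous_integral_uniformSphere {d : ℕ} {f : ℝ → ℂ} (hf : Continuous f)
    (e : EuclideanSpace ℝ (Fin d)) :
    Continuous fun r : ℝ => ∫ ξ, f (r * ⟪e, ξ.1⟫_ℝ) ∂uniformSphere d := by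
  simp only [integral_uniformSphere]
  have := continuous_parametric_integral_of_continuous
    (X := ℝ) (μ := (volume : Measure (EuclideanSpace ℝ (Fin d))).toSphere)
    (f := fun (r : ℝ) (ξ : sphere (0 : EuclideanSpace ℝ (Fin d)) 1) => f (r * ⟪e, ξ.1⟫_ℝ))
    (s := univ) (by fun_prop) isCompact_univ
  simp only [Measure.restrict_univ] at this
  exact this.const_smul (_ : ℝ)

/-- A radial factor is constant on each sphere and comes out of the spherical mean. -/
theorem integral_ridge_mul_radial {d : ℕ} (hd : 1 ≤ d) {f : ℝ → ℂ} (hf : Continuous f)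
    {η : EuclideanSpace ℝ (Fin d) → ℂ} (hηc : Continuous η) (hηs : HasCompactSupport η)
    (hη : ∀ x y, ‖x‖ = ‖y‖ → η x = η y) (e : EuclideanSpace ℝ (Fin d)) :
    ∫ x, f ⟪e, x⟫_ℝ * η x =
      ∫ x, (∫ ξ, f (‖x‖ * ⟪e, ξ.1⟫_ℝ) ∂uniformSphere d) * η x := by
  rw [integral_eq_integral_uniformSphere hd (Φ := fun x => f ⟪e, x⟫_ℝ * η x)
    (Continuous.integrable_of_hasCompactSupport (by fun_prop) hηs.mul_left)]
  refine integral_congr_ae (Eventually.of_forall fun x => ?_)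
  have h1 : ∀ ξ : sphere (0 : EuclideanSpace ℝ (Fin d)) 1, η (‖x‖ • ξ.1) = η x := fun ξ =>
    hη _ _ (by simp [norm_smul])
  simp only [h1, inner_smul_right]
  exact integral_mul_const _ _

/-! ### Localization by radial bumps -/

/-- A locally integrable radial function that annihilates all radial test functions vanishes
wherever its profile is continuous. -/
theorem radial_eq_zero_of_integral_eq_zero {E : Type*} [NormedAddCommGroup E]
    [InnerProductSpace ℝ E] [FiniteDimensional ℝ E] [MeasurableSpace E] [BorelSpace E]
    {K : ℝ≥0 → ℂ} (hK : LocallyIntegrable fun x : E => K ‖x‖₊)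
    (h : ∀ η : 𝓢(E, ℂ), HasCompactSupport η → (∀ x y, ‖x‖ = ‖y‖ → η x = η y) →
      ∫ x, K ‖x‖₊ * η x = 0)
    {z : E} (hz : ContinuousAt K ‖z‖₊) : K ‖z‖₊ = 0 := by
  by_contra hne
  -- The profile is rewritten in the variable ‖x‖², because a bump in ‖x‖² is smooth at the origin
  -- too.
  have hsqrt : ∀ x : E, NNReal.sqrt (Real.toNNReal (‖x‖ ^ 2)) = ‖x‖₊ := fun x => by
    rw [Real.toNNReal_pow (norm_nonneg x), norm_toNNReal, NNReal.sqrt_sq]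
  have hK' : ContinuousAt (fun s : ℝ => K (NNReal.sqrt (Real.toNNReal s))) (‖z‖ ^ 2) := by
    refine ContinuousAt.comp (g := K) ?_ (by fun_prop)
    rwa [hsqrt]
  obtain ⟨δ, hδ, hKδ⟩ := Metric.continuousAt_iff.1 hK' (‖K ‖z‖₊‖ / 2) (by positivity)
  let b : ContDiffBump (‖z‖ ^ 2) := ⟨δ / 2, δ, by linarith, by linarith⟩
  have hbc : ContDiff ℝ ∞ fun x : E => b (‖x‖ ^ 2) := b.contDiff.comp (contDiff_norm_sq ℝ)
  have hbs : HasCompactSupport fun x : E => b (‖x‖ ^ 2) := by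
    refine HasCompactSupport.intro (isCompact_closedBall 0 (‖z‖ ^ 2 + δ + 1)) fun x hx => ?_
    -- The extra 1 makes ‖x‖ > 1, hence ‖x‖² > ‖x‖ > ‖z‖² + δ.
    have hx' : ‖z‖ ^ 2 + δ + 1 < ‖x‖ := by simpa using hx
    refine b.zero_of_le_dist ?_
    rw [Real.dist_eq]
    refine le_trans ?_ (le_abs_self _)
    change δ ≤ _
    nlinarith [sq_nonneg ‖z‖]
  have hbpos : 0 < ∫ x : E, b (‖x‖ ^ 2) :=
    hbc.continuous.integral_pos_of_hasCompactSupport_nonneg_nonzero hbs (fun _ => b.nonneg)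
      (x := z) (by
        rw [b.one_of_mem_closedBall (mem_closedBall_self b.rIn_pos.le)]
        exact one_ne_zero)
  have hbi : Integrable fun x : E => b (‖x‖ ^ 2) :=
    hbc.continuous.integrable_of_hasCompactSupport hbs
  have h0 : ∫ x : E, K ‖x‖₊ * (b (‖x‖ ^ 2) : ℂ) = 0 :=
    h ((hbs.comp_left (g := ((↑) : ℝ → ℂ)) Complex.ofReal_zero).toSchwartzMap
      (Complex.ofRealCLM.contDiff.comp hbc)) (hbs.comp_left Complex.ofReal_zero)
      (fun x y hxy => show ((b (‖x‖ ^ 2) : ℝ) : ℂ) = (b (‖y‖ ^ 2) : ℝ) by rw [hxy])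
  have hbi' : Integrable fun x : E => (b (‖x‖ ^ 2) : ℂ) := hbi.ofReal
  have hKi : Integrable fun x : E => K ‖x‖₊ * (b (‖x‖ ^ 2) : ℂ) := by
    have := hK.integrable_smul_left_of_hasCompactSupport hbc.continuous hbs
    simpa [mul_comm] using this
  have h1 : ∫ x : E, (K ‖x‖₊ - K ‖z‖₊) * (b (‖x‖ ^ 2) : ℂ) =
      -(K ‖z‖₊ * ((∫ x : E, b (‖x‖ ^ 2) : ℝ) : ℂ)) := by
    simp only [sub_mul]
    rw [integral_sub hKi (hbi'.const_mul _), h0, zero_sub, integral_const_mul]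
    congr 2
    exact integral_ofReal
  -- On the support of the bump `K` is within half of its nonzero value at `z`. So `h1` and `h2`
  -- give |K(z)| ∫ b ≤ (|K(z)|/2) ∫ b, impossible since ∫ b > 0.
  have h2 : ‖∫ x : E, (K ‖x‖₊ - K ‖z‖₊) * (b (‖x‖ ^ 2) : ℂ)‖ ≤
      ∫ x : E, ‖K ‖z‖₊‖ / 2 * b (‖x‖ ^ 2) := by
    refine norm_integral_le_of_norm_le (hbi.const_mul _) (Eventually.of_forall fun x => ?_)
    rw [norm_mul, Complex.norm_real, Real.norm_of_nonneg b.nonneg]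
    by_cases hx : dist (‖x‖ ^ 2) (‖z‖ ^ 2) < δ
    · have := hKδ hx
      rw [hsqrt, hsqrt, dist_eq_norm] at this
      exact mul_le_mul_of_nonneg_right this.le b.nonneg
    · rw [b.zero_of_le_dist (not_lt.1 hx)]
      simp
  rw [h1, norm_neg, norm_mul, Complex.norm_real, Real.norm_of_nonneg hbpos.le,
    integral_const_mul] at h2
  have : 0 < ‖K ‖z‖₊‖ := norm_pos_iff.2 hne
  nlinarith

end Slicing

/-! ### The pointwise slicing formula -/

theorem mainTheorem1 (d : ℕ) (hd : 1 ≤ d) (F : ℝ≥0 → ℝ) (f : ℝ → ℂ)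
    (hF : Slicing.SlowlyIncreasing (Slicing.rotationOp d F))
    (hf : Slicing.SlowlyIncreasing f)
    (hfF : Slicing.slicingOperator d hF.toDistribution = hf.toDistribution)
    (hfc : Continuous f)
    (z : EuclideanSpace ℝ (Fin d)) (hz : ContinuousAt F ‖z‖₊) :
    (F ‖z‖₊ : ℂ) = ∫ ξ : Metric.sphere (0 : EuclideanSpace ℝ (Fin d)) 1,
      f |inner ℝ z (ξ : EuclideanSpace ℝ (Fin d))| ∂(Slicing.uniformSphere d) := by
  obtain ⟨n, rfl⟩ : ∃ n, d = n + 1 := ⟨d - 1, by omega⟩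
  -- At z = 0 any unit vector serves as the direction.
  obtain ⟨e, he, hez⟩ : ∃ e : EuclideanSpace ℝ (Fin (n + 1)), ‖e‖ = 1 ∧ z = ‖z‖ • e := by
    rcases eq_or_ne z 0 with rfl | h0
    · exact ⟨EuclideanSpace.single 0 1, by simp, by simp⟩
    · exact ⟨‖z‖⁻¹ • z, by simp [norm_smul, h0], by simp [smul_smul, h0]⟩
  set H : ℝ → ℂ := fun r => ∫ ξ, f (r * ⟪e, ξ.1⟫_ℝ) ∂Slicing.uniformSphere (n + 1) with hH
  have hHc : Continuous H := Slicing.continuous_integral_uniformSphere hfc e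
  have hHn : Continuous fun x : EuclideanSpace ℝ (Fin (n + 1)) => H ‖x‖ := by fun_prop
  have key : (F ‖z‖₊ : ℂ) - H (‖z‖₊ : ℝ) = 0 := by
    refine Slicing.radial_eq_zero_of_integral_eq_zero (K := fun r => (F r : ℂ) - H r)
      (hF.1.sub hHn.locallyIntegrable) (fun η hηs hη => ?_) ?_
    · have h1 := Slicing.apply_radial_eq_integral_ridge hf hfF hfc η hηs hη he
      rw [hF.toDistribution_apply,
        Slicing.integral_ridge_mul_radial hd hfc η.continuous hηs hη e] at h1
      simp only [sub_mul]
      obtain ⟨_, _, _, hb⟩ := hF.exists_bound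
      refine (integral_sub (hb η).1 (Continuous.integrable_of_hasCompactSupport
        (hHn.mul η.continuous) hηs.mul_left)).trans (sub_eq_zero.2 h1)
    · have := Complex.continuous_ofReal.continuousAt.comp hz
      exact this.sub (by fun_prop)
  rw [sub_eq_zero.1 key]
  -- H(‖z‖) averages f(⟨z, ξ⟩); evenness of `f` then supplies the absolute value.
  refine integral_congr_ae (Eventually.of_forall fun ξ => ?_)
  have h2 : ‖z‖ * ⟪e, ξ.1⟫_ℝ = ⟪z, ξ.1⟫_ℝ := by
    conv_rhs => rw [hez, real_inner_smul_left]
  simp only [coe_nnnorm, h2]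
  rcases abs_choice ⟪z, ξ.1⟫_ℝ with h | h
  · rw [h]
  · rw [h, Slicing.even_of_slicingOperator_eq hf hfF hfc]
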